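/- Let $D\ge 1$ and equip every tensor space $\mathbb{R}^{n\times\cdots\times n}$ ($D$ factors) with the Frobenius norm. Let $\mathcal{V}_{n,D}=\{\alpha\,\mathbf{a}^{\otimes D} : \alpha\in\mathbb{R}\setminus\{0\},\ \mathbf{a}\in\mathbb{R}^n,\ \|\mathbf{a}\|_2=1\}$ be the Veronese manifold, and for $Q\in\mathbb{R}^{n\times m}$ let $\mathcal{W}_{Q,D}=Q^{\otimes D}(\mathcal{V}_{m,D})$, where $Q^{\otimes D}\mathcal{T}=(Q,\dots,Q)\cdot\mathcal{T}$ is multilinear multiplication. For a subset $\mathcal{M}$ of a tensor space and $\mathfrak{a}=(\mathcal{A}_1,\dots,\mathcal{A}_R)\in\mathcal{M}^{\times R}$ let $\Sigma:\mathcal{M}^{\times R}\to\mathbb{R}^{n\times\cdots\times n}$ be the addition map $(\mathcal{X}_1,\dots,\mathcal{X}_R)\mapsto\mathcal{X}_1+\cdots+\mathcal{X}_R$, put $\mathcal{A}=\Sigma(\mathfrak{a})$, and give $R$-tuples of tensors the Euclidean product norm. If $\Sigma$ is injective on some open neighbourhood $\mathcal{N}$ of $\mathfrak{a}$ in $\mathcal{M}^{\times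 R}$ and its inverse $\Sigma_{\mathfrak{a}}^{-1}:\Sigma(\mathcal{N})\to\mathcal{N}$ is continuous, define $$\kappa_{\mathcal{M}}(\mathcal{A}_1,\dots,\mathcal{A}_R)=\lim_{\delta\to0^+}\ \sup_{\widetilde{\mathcal{A}}\in\Sigma(\mathcal{N}),\ 0<\|\mathcal{A}-\widetilde{\mathcal{A}}\|\le\delta}\frac{\|\Sigma_{\mathfrak{a}}^{-1}(\mathcal{A})-\Sigma_{\mathfrak{a}}^{-1}(\widetilde{\mathcal{A}})\|}{\|\mathcal{A}-\widetilde{\mathcal{A}}\|}\in[0,\infty]$$ (this does not depend on the choice of $\mathcal{N}$; a supremum over the empty set is $0$); if there is no such $\mathcal{N}$, define $\kappa_{\mathcal{M}}(\mathcal{A}_1,\dots,\mathcal{A}_R)=\infty$. **Theorem.** Let $\mathcal{G}=\mathcal{G}_1+\cdots+\mathcal{G}_R$ with $\mathcal{G}_r\in\mathcal{V}_{m,D}$ for $r=1,\dots,R$ be a Waring decomposition. (i) Let $Q\in\mathbb{R}^{n\times m}$ have orthonormal columns and put $\mathcal{A}_r=Q^{\otimes D}\mathcal{G}_r$. Then $$\kappa_{\mathcal{W}_{Q,D}}(\mathcal{A}_1,\dots,\mathcal{A}_R)\le\kappa_{\mathcal{V}_{n,D}}(\mathcal{A}_1,\dots,\mathcal{A}_R)\le\sqrt{D}\cdot\kappa_{\mathcal{V}_{m,D}}(\mathcal{G}_1,\dots,\mathcal{G}_R)$$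 and $\kappa_{\mathcal{V}_{m,D}}(\mathcal{G}_1,\dots,\mathcal{G}_R)=\kappa_{\mathcal{W}_{Q,D}}(\mathcal{A}_1,\dots,\mathcal{A}_R)$. (ii) With $Q$ and $\mathcal{A}_r$ as in (i), let $U\in\mathbb{R}^{\ell\times m}$ have orthonormal columns and put $\mathcal{B}_r=U^{\otimes D}\mathcal{G}_r$. If $\min(\ell,n)>m$, then $$\kappa_{\mathcal{V}_{n,D}}(\mathcal{A}_1,\dots,\mathcal{A}_R)=\kappa_{\mathcal{V}_{\ell,D}}(\mathcal{B}_1,\dots,\mathcal{B}_R).$$ -/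

import Mathlib

open scoped ENNReal Topology Matrix

namespace WaringCond

/-- Real order-`D` tensors of format `n × ⋯ × n`: arrays with entries indexed by
`(i_1, …, i_D)`, with the Frobenius (Euclidean) norm. -/
abbrev Tensor (n D : ℕ) : Type := EuclideanSpace ℝ (Fin D → Fin n)

/-- The tensor power `a^{⊗D}`, with entries `a_{i_1} ⋯ a_{i_D}`. -/
noncomputable def tensorPow {n : ℕ} (D : ℕ) (a : EuclideanSpace ℝ (Fin n)) : Tensor n D :=
  WithLp.toLp 2 fun i => ∏ d, a (i d)

/-- The multilinear multiplication `Q^{⊗D} T = (Q, …, Q) · T`. -/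
noncomputable def tuckerMul {n m : ℕ} (D : ℕ) (Q : Matrix (Fin n) (Fin m) ℝ) (T : Tensor m D) :
    Tensor n D :=
  WithLp.toLp 2 fun i => ∑ j : Fin D → Fin m, (∏ d, Q (i d) (j d)) * T j

/-- The Veronese manifold `V_{n,D}`: all `α a^{⊗D}` with `α ≠ 0` and `a` in the unit sphere. -/
def veronese (n D : ℕ) : Set (Tensor n D) :=
  {T | ∃ (α : ℝ) (a : EuclideanSpace ℝ (Fin n)), α ≠ 0 ∧ ‖a‖ = 1 ∧ T = α • tensorPow D a}

/-- The manifold `W_{Q,D} = Q^{⊗D}(V_{m,D})`. -/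
def compressedVeronese {n m : ℕ} (Q : Matrix (Fin n) (Fin m) ℝ) (D : ℕ) : Set (Tensor n D) :=
  tuckerMul D Q '' veronese m D

/-- Applying `Q^{⊗D}` to every summand of a decomposition. -/
noncomputable def tuckerMulEach {n m D R : ℕ} (Q : Matrix (Fin n) (Fin m) ℝ)
    (G : PiLp 2 (fun _ : Fin R => Tensor m D)) : PiLp 2 (fun _ : Fin R => Tensor n D) :=
  WithLp.toLp 2 fun r => tuckerMul D Q (G r)

section ConditionNumber

variable {E : Type*} [NormedAddCommGroup E] {R : ℕ}

/-- The product `M^{×R}`; the ambient `R`-tuples carry the Euclidean product norm. -/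
def prodSet (M : Set E) (R : ℕ) : Set (PiLp 2 (fun _ : Fin R => E)) :=
  {b | ∀ r, b r ∈ M}

/-- The addition map `(A_1, …, A_R) ↦ A_1 + ⋯ + A_R`. -/
def addMap (b : PiLp 2 (fun _ : Fin R => E)) : E := ∑ r, b r

/-- `g` is a local inverse at `a` of the addition map on `M^{×R}`: on an open neighbourhood
`U ∩ M^{×R}` of `a` in `M^{×R}`, the addition map is injective with inverse `g`, and `g` is
continuous on the image of this neighbourhood. -/
structure IsLocalInverse (M : Set E) (a : PiLp 2 (fun _ : Fin R => E))
    (U : Set (PiLp 2 (fun _ : Fin R => E))) (g : E → PiLp 2 (fun _ : Fin R => E)) : Prop where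
  isOpen : IsOpen U
  mem : a ∈ U
  leftInv : ∀ b ∈ U ∩ prodSet M R, g (addMap b) = b
  continuousOn : ContinuousOn g (addMap '' (U ∩ prodSet M R))

/-- `sup ‖g(A) - g(B)‖ / ‖A - B‖` over all `B ∈ S` with `0 < ‖A - B‖ ≤ δ`. -/
noncomputable def ratioSup {F : Type*} [NormedAddCommGroup F] (S : Set E) (g : E → F) (A : E)
    (δ : ℝ) : ℝ≥0∞ :=
  ⨆ (B : E) (_ : B ∈ S) (_ : B ≠ A) (_ : ‖A - B‖ ≤ δ), ENNReal.ofReal (‖g A - g B‖ / ‖A - B‖)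

/-- Rice's condition number of `g : S → F` at `A`: the limit for `δ → 0+` of the suprema
`ratioSup S g A δ`, which is their infimum since they are monotone in `δ`. -/
noncomputable def riceCond {F : Type*} [NormedAddCommGroup F] (S : Set E) (g : E → F) (A : E) :
    ℝ≥0∞ :=
  ⨅ (δ : ℝ) (_ : 0 < δ), ratioSup S g A δ

theorem ratioSup_mono {F : Type*} [NormedAddCommGroup F] (S : Set E) (g : E → F) (A : E) :
    Monotone (ratioSup S g A) := by
  intro δ ε h
  unfold ratioSup
  gcongr with B hB hBA
  exact iSup_mono' fun h1 => ⟨h1.trans h, le_rfl⟩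

theorem tendsto_ratioSup {F : Type*} [NormedAddCommGroup F] (S : Set E) (g : E → F) (A : E) :
    Filter.Tendsto (ratioSup S g A) (𝓝[>] 0) (𝓝 (riceCond S g A)) := by
  have h := (ratioSup_mono S g A).tendsto_nhdsGT 0
  rw [sInf_image] at h
  exact h

/-- The condition number `κ_M(a_1, …, a_R)` of a decomposition `a ∈ M^{×R}`: the condition number
at `a_1 + ⋯ + a_R` of a local inverse at `a` of the addition map on `M^{×R}`, and `∞` if there is
no local inverse (the infimum of the empty family). The infimum is over a family of equal values,
see `condNumber_eq`. -/
noncomputable def condNumber (M : Set E) (a : PiLp 2 (fun _ : Fin R => E)) : ℝ≥0∞ :=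
  ⨅ (U : Set (PiLp 2 (fun _ : Fin R => E))) (g : E → PiLp 2 (fun _ : Fin R => E))
    (_ : IsLocalInverse M a U g), riceCond (addMap '' (U ∩ prodSet M R)) g (addMap a)

theorem riceCond_le {M : Set E} {a : PiLp 2 (fun _ : Fin R => E)} (ha : a ∈ prodSet M R)
    {U V : Set (PiLp 2 (fun _ : Fin R => E))} {g h : E → PiLp 2 (fun _ : Fin R => E)}
    (hg : IsLocalInverse M a U g) (hh : IsLocalInverse M a V h) :
    riceCond (addMap '' (U ∩ prodSet M R)) g (addMap a) ≤
      riceCond (addMap '' (V ∩ prodSet M R)) h (addMap a) := by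
  have hga : g (addMap a) = a := hg.leftInv a ⟨hg.mem, ha⟩
  have hha : h (addMap a) = a := hh.leftInv a ⟨hh.mem, ha⟩
  have hc := hg.continuousOn (addMap a) ⟨a, ⟨hg.mem, ha⟩, rfl⟩
  have hV : V ∈ 𝓝 (g (addMap a)) := by rw [hga]; exact hh.isOpen.mem_nhds hh.mem
  obtain ⟨ε, hε, hsub⟩ := Metric.mem_nhdsWithin_iff.1 (hc hV)
  refine le_iInf₂ fun δ hδ => ?_
  refine (iInf₂_le (min δ (ε / 2)) (lt_min hδ (half_pos hε))).trans ?_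
  refine iSup_le fun B => iSup_le fun hB => iSup_le fun hBA => iSup_le fun hBδ => ?_
  obtain ⟨b, hb, rfl⟩ := hB
  have hbV : b ∈ V := by
    have hd : addMap b ∈ Metric.ball (addMap a) ε := by
      rw [Metric.mem_ball, dist_comm, dist_eq_norm]
      have := hBδ.trans (min_le_right _ _)
      linarith
    have h2 := hsub ⟨hd, b, hb, rfl⟩
    rw [Set.mem_preimage, hg.leftInv b hb] at h2
    exact h2
  rw [hga, hg.leftInv b hb]
  have key : ENNReal.ofReal (‖a - b‖ / ‖addMap a - addMap b‖) =
      ENNReal.ofReal (‖h (addMap a) - h (addMap b)‖ / ‖addMap a - addMap b‖) := by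
    rw [hha, hh.leftInv b ⟨hbV, hb.2⟩]
  rw [key]
  unfold ratioSup
  exact le_iSup_of_le (addMap b) (le_iSup_of_le ⟨b, ⟨hbV, hb.2⟩, rfl⟩
    (le_iSup_of_le hBA (le_iSup_of_le (hBδ.trans (min_le_left _ _)) le_rfl)))

/-- `condNumber` is the condition number of any local inverse. -/
theorem condNumber_eq {M : Set E} {a : PiLp 2 (fun _ : Fin R => E)} (ha : a ∈ prodSet M R)
    {U : Set (PiLp 2 (fun _ : Fin R => E))} {g : E → PiLp 2 (fun _ : Fin R => E)}
    (hg : IsLocalInverse M a U g) :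
    condNumber M a = riceCond (addMap '' (U ∩ prodSet M R)) g (addMap a) :=
  le_antisymm (iInf_le_of_le U (iInf_le_of_le g (iInf_le _ hg)))
    (le_iInf fun _ => le_iInf fun _ => le_iInf fun hh => riceCond_le ha hg hh)

end ConditionNumber

end WaringCond

/-! The condition number is read off the tangent spaces: `κ_M(a)` is the least `C` with `‖w‖ ≤ C ‖∑
w_r‖` for all `w_r` tangent to `M` at `a_r`, and `∞` if there is none (`norm_le_of_condNumber_le`,
`condNumber_le_of_norm_le`). Hence condition numbers are compared through such linear estimates.

For `W_{Q,D}` the estimate is that of `V_{m,D}` carried over by the isometry `Q^{⊗D}`. For `V_{n,D}`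
the tangent space at `α a^{⊗D}` consists of all `symTensor D a u`. Split each direction `u_r` into
`Q y_r` and `z_r` orthogonal to the range of `Q`. By `inner_symTensor` the two kinds of tangent
vectors are orthogonal, and the `z`-part has Gram matrix `D ⟪z_r, z_s⟫ ⟪x_r, x_s⟫^(D-1)`. That part
obeys the same constant `C`: testing the estimate on `V_{m,D}` with `c_r e_j` and summing over an
orthonormal basis `e_j` bounds the matrix `⟪x_r, x_s⟫^(D-1)` from below (`sum_sq_le_gram`). So all
three condition numbers coincide, which is stronger than the bound with `√D` and gives (ii) at once.
-/

namespace WaringCond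

/-! ### Upper bounds for the condition number from expansion of the addition map -/

section Antilipschitz

variable {E : Type*} [NormedAddCommGroup E] {R : ℕ}

theorem addMap_sub (v w : PiLp 2 (fun _ : Fin R => E)) :
    addMap (v - w) = addMap v - addMap w := by
  simp [addMap, Finset.sum_sub_distrib]

theorem norm_addMap_le (v : PiLp 2 (fun _ : Fin R => E)) : ‖addMap v‖ ≤ R * ‖v‖ := by
  refine (norm_sum_le _ _).trans ?_
  refine (Finset.sum_le_card_nsmul _ _ _ fun r _ => PiLp.norm_apply_le v r).trans ?_
  simp

theorem norm_le_of_forall_norm_le {ε : ℝ} (hε : 0 ≤ ε) {v w : PiLp 2 (fun _ : Fin R => E)}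
    (h : ∀ r, ‖v r‖ ≤ ε * ‖w r‖) : ‖v‖ ≤ ε * ‖w‖ := by
  refine le_of_sq_le_sq ?_ (by positivity)
  rw [mul_pow, PiLp.norm_sq_eq_of_L2, PiLp.norm_sq_eq_of_L2, Finset.mul_sum]
  exact Finset.sum_le_sum fun r _ => by rw [← mul_pow]; gcongr; exact h r

/-- The estimate does double duty: it makes the inverse exist and be Lipschitz, hence continuous,
and it bounds every difference quotient by `C`. -/
theorem condNumber_le_of_antilipschitz {M : Set E} {a : PiLp 2 (fun _ : Fin R => E)}
    (ha : a ∈ prodSet M R) {C : ℝ} (hC0 : 0 ≤ C) {U : Set (PiLp 2 (fun _ : Fin R => E))}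
    (hU : IsOpen U) (haU : a ∈ U)
    (h : ∀ b ∈ U ∩ prodSet M R, ∀ c ∈ U ∩ prodSet M R, ‖b - c‖ ≤ C * ‖addMap b - addMap c‖) :
    condNumber M a ≤ ENNReal.ofReal C := by
  have hinj : Set.InjOn addMap (U ∩ prodSet M R) := by
    intro b hb c hc hbc
    have := h b hb c hc
    rw [hbc, sub_self, norm_zero, mul_zero] at this
    exact sub_eq_zero.1 (norm_le_zero_iff.1 this)
  set g := Function.invFunOn addMap (U ∩ prodSet M R) with hg
  have hleft : ∀ b ∈ U ∩ prodSet M R, g (addMap b) = b := fun b hb => hinj.leftInvOn_invFunOn hb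
  have hloc : IsLocalInverse M a U g := by
    refine ⟨hU, haU, hleft, LipschitzOnWith.continuousOn (K := C.toNNReal) ?_⟩
    refine LipschitzOnWith.of_dist_le_mul ?_
    rintro _ ⟨b, hb, rfl⟩ _ ⟨c, hc, rfl⟩
    rw [hleft b hb, hleft c hc, dist_eq_norm, dist_eq_norm, Real.coe_toNNReal C hC0]
    exact h b hb c hc
  rw [condNumber_eq ha hloc]
  refine (iInf₂_le 1 one_pos).trans ?_
  refine iSup_le fun B => iSup_le fun hB => iSup_le fun hBA => iSup_le fun _ => ?_
  obtain ⟨b, hb, rfl⟩ := hB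
  apply ENNReal.ofReal_le_ofReal
  rw [hleft b hb, hleft a ⟨haU, ha⟩]
  exact div_le_of_le_mul₀ (norm_nonneg _) hC0 (h a ⟨haU, ha⟩ b hb)

end Antilipschitz

/-! ### The condition number in terms of tangent vectors -/

section TangentVectors

variable {E : Type*} [NormedAddCommGroup E] [NormedSpace ℝ E] {R : ℕ}

/-- `T` is the set of tangent vectors of `M` at `a`: they are velocities of curves in `M`, and
differences of points of `M` near `a` are approximated by elements of `T` to first order. -/
structure IsTangentSet (M : Set E) (a : E) (T : Set E) : Prop where
  curve : ∀ t ∈ T, ∃ γ : ℝ → E, HasDerivAt γ t 0 ∧ γ 0 = a ∧ ∀ᶠ s in 𝓝 0, γ s ∈ M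
  approx : ∀ ε > 0, ∀ᶠ p in 𝓝 a ×ˢ 𝓝 a, p.1 ∈ M → p.2 ∈ M →
    ∃ t ∈ T, ‖p.1 - p.2 - t‖ ≤ ε * ‖p.1 - p.2‖

theorem IsTangentSet.image {F : Type*} [NormedAddCommGroup F] [NormedSpace ℝ F] {M : Set E} {a : E}
    {T : Set E} (h : IsTangentSet M a T) (L : E →ₗᵢ[ℝ] F) :
    IsTangentSet (L '' M) (L a) (L '' T) := by
  constructor
  · rintro _ ⟨t, ht, rfl⟩
    obtain ⟨γ, h1, h2, h3⟩ := h.curve t ht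
    refine ⟨fun s => L (γ s), ?_, congrArg L h2, h3.mono fun s hs => ⟨_, hs, rfl⟩⟩
    exact L.toContinuousLinearMap.hasFDerivAt.comp_hasDerivAt 0 h1
  · intro ε hε
    have h1 := h.approx ε hε
    rw [L.isometry.isEmbedding.nhds_eq_comap, Filter.prod_comap_comap_eq,
      Filter.eventually_comap] at h1
    filter_upwards [h1] with p hp
    rintro ⟨x, hx, hx'⟩ ⟨y, hy, hy'⟩
    obtain ⟨t, ht, hle⟩ := hp (x, y) (Prod.ext hx' hy') hx hy
    refine ⟨L t, ⟨t, ht, rfl⟩, ?_⟩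
    rw [← hx', ← hy', ← map_sub, ← map_sub, L.norm_map, L.norm_map]
    exact hle

/-- Move each summand along a curve in `M` with velocity `w r`; the bound on difference quotients
passes to the limit of slopes. -/
theorem norm_le_of_condNumber_le {M : Set E} {a : PiLp 2 (fun _ : Fin R => E)}
    (ha : a ∈ prodSet M R) {T : Fin R → Set E} (hT : ∀ r, IsTangentSet M (a r) (T r)) {C : ℝ}
    (hC : condNumber M a ≤ ENNReal.ofReal C) (hC0 : 0 ≤ C) (w : PiLp 2 (fun _ : Fin R => E))
    (hw : ∀ r, w r ∈ T r) : ‖w‖ ≤ C * ‖addMap w‖ := by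
  -- The infimum over `δ` need not be attained, so a strictly larger constant is used and then sent
  -- to `C`.
  have key : ∀ C' > C, ‖w‖ ≤ C' * ‖addMap w‖ := by
    intro C' hC'
    have hlt : condNumber M a < ENNReal.ofReal C' :=
      hC.trans_lt ((ENNReal.ofReal_lt_ofReal_iff (hC0.trans_lt hC')).2 hC')
    unfold condNumber at hlt
    simp only [iInf_lt_iff] at hlt
    obtain ⟨U, g, hg, hlt⟩ := hlt
    unfold riceCond at hlt
    simp only [iInf_lt_iff] at hlt
    obtain ⟨δ, hδ, hlt⟩ := hlt
    choose γ hγ hγ0 hγM using fun r => (hT r).curve (w r) (hw r)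
    set b : ℝ → PiLp 2 (fun _ : Fin R => E) := fun s => WithLp.toLp 2 fun r => γ r s with hb
    have hb0 : b 0 = a := by ext r; simp [hb, hγ0]
    have hbd : HasDerivAt b w 0 := by
      rw [← hasDerivWithinAt_univ, hasDerivWithinAt_iff_hasFDerivWithinAt, hasFDerivWithinAt_piLp]
      intro r
      exact (hγ r).hasFDerivAt.hasFDerivWithinAt
    have hsd : HasDerivAt (fun s => addMap (b s)) (addMap w) 0 :=
      HasDerivAt.fun_sum fun r _ => hγ r
    have hbU : ∀ᶠ s in 𝓝 0, b s ∈ U ∩ prodSet M R := by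
      have h1 : ∀ᶠ s in 𝓝 0, b s ∈ U :=
        hbd.continuousAt.eventually_mem (by rw [hb0]; exact hg.isOpen.mem_nhds hg.mem)
      have h2 : ∀ᶠ s in 𝓝 0, ∀ r, γ r s ∈ M := Filter.eventually_all.2 hγM
      filter_upwards [h1, h2] with s h1 h2 using ⟨h1, h2⟩
    have hnear : ∀ᶠ s in 𝓝 0, ‖addMap a - addMap (b s)‖ ≤ δ := by
      have h1 := hsd.continuousAt.eventually_mem
        (Metric.closedBall_mem_nhds (addMap (b 0)) hδ)
      filter_upwards [h1] with s hs
      rwa [hb0, Metric.mem_closedBall, dist_comm, dist_eq_norm] at hs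
    have hga := hg.leftInv a ⟨hg.mem, ha⟩
    have hbound : ∀ᶠ s in 𝓝 0, ‖b s - b 0‖ ≤ C' * ‖addMap (b s) - addMap (b 0)‖ := by
      filter_upwards [hbU, hnear] with s h1 h2
      have hgb := hg.leftInv _ h1
      rw [hb0]
      -- The quotient is taken only over sums different from `addMap a`; equal sums force `b s = a`
      -- by the left inverse.
      by_cases hne : addMap (b s) = addMap a
      · have : b s = a := by rw [← hgb, hne, hga]
        simp [this]
      · have hpos : 0 < ‖addMap a - addMap (b s)‖ := norm_pos_iff.2 (sub_ne_zero.2 (Ne.symm hne))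
        have h3 : ENNReal.ofReal (‖g (addMap a) - g (addMap (b s))‖ /
            ‖addMap a - addMap (b s)‖) ≤ ratioSup (addMap '' (U ∩ prodSet M R)) g (addMap a) δ :=
          le_iSup_of_le (addMap (b s)) (le_iSup_of_le ⟨_, h1, rfl⟩
            (le_iSup_of_le hne (le_iSup_of_le h2 le_rfl)))
        have h4 := (ENNReal.ofReal_lt_ofReal_iff (hC0.trans_lt hC')).1 (h3.trans_lt hlt)
        rw [hga, hgb, div_lt_iff₀ hpos] at h4
        rw [norm_sub_rev, norm_sub_rev (addMap (b s))]
        exact h4.le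
    have t1 := (hasDerivAt_iff_tendsto_slope.1 hbd).norm
    have t2 := ((hasDerivAt_iff_tendsto_slope.1 hsd).norm).const_mul C'
    refine le_of_tendsto_of_tendsto t1 t2 ?_
    filter_upwards [hbound.filter_mono nhdsWithin_le_nhds] with s hs
    simp only [slope_def_module, norm_smul, sub_zero]
    rw [mul_left_comm]
    gcongr
  have hlim : Filter.Tendsto (fun C' : ℝ => C' * ‖addMap w‖) (𝓝[>] C) (𝓝 (C * ‖addMap w‖)) :=
    ((continuous_id.mul continuous_const).tendsto C).mono_left nhdsWithin_le_nhds
  exact ge_of_tendsto hlim (Filter.eventually_of_mem self_mem_nhdsWithin key)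

/-- Near `a`, the difference of two points of the product is a tangent tuple up to relative error
`ε`, so the tangent estimate becomes an antilipschitz estimate with any constant above `C`. Both
points vary, since injectivity on a neighbourhood is needed. -/
theorem condNumber_le_of_norm_le {M : Set E} {a : PiLp 2 (fun _ : Fin R => E)}
    (ha : a ∈ prodSet M R) {T : Fin R → Set E} (hT : ∀ r, IsTangentSet M (a r) (T r)) {C : ℝ}
    (hC0 : 0 ≤ C) (hC : ∀ w : PiLp 2 (fun _ : Fin R => E), (∀ r, w r ∈ T r) →
      ‖w‖ ≤ C * ‖addMap w‖) : condNumber M a ≤ ENNReal.ofReal C := by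
  have key : ∀ C' > C, condNumber M a ≤ ENNReal.ofReal C' := by
    intro C' hC'
    have hC'0 : 0 < C' := hC0.trans_lt hC'
    -- The total error is `ε (1 + C R) ‖b - c‖`, with `R` bounding the addition map. After
    -- multiplication by `C'`, absorbing it leaves the coefficient `(C' + C) / 2 ≥ C`.
    obtain ⟨ε, hε, hεC⟩ : ∃ ε > 0, ε * (C' * (1 + C * R)) ≤ (C' - C) / 2 :=
      ⟨(C' - C) / 2 / (C' * (1 + C * R)), div_pos (half_pos (sub_pos.2 hC')) (by positivity),
        (div_mul_cancel₀ _ (by positivity)).le⟩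
    have h1 : ∀ r, ∃ V : Set E, IsOpen V ∧ a r ∈ V ∧ ∀ x ∈ V ∩ M, ∀ y ∈ V ∩ M,
        ∃ t ∈ T r, ‖x - y - t‖ ≤ ε * ‖x - y‖ := by
      intro r
      obtain ⟨S, hS, h⟩ := Filter.eventually_prod_self_iff'.1 ((hT r).approx ε hε)
      obtain ⟨V, hVS, hV, haV⟩ := mem_nhds_iff.1 hS
      exact ⟨V, hV, haV, fun x hx y hy => h x (hVS hx.1) y (hVS hy.1) hx.2 hy.2⟩
    choose V hV haV happ using h1
    refine condNumber_le_of_antilipschitz (U := {b | ∀ r, b r ∈ V r}) ha hC'0.le ?_ haV ?_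
    · simp only [Set.ofPred_forall]
      exact isOpen_iInter_of_finite fun r => (hV r).preimage (by fun_prop)
    · intro b hb c hc
      choose t ht hle using fun r => happ r (b r) ⟨hb.1 r, hb.2 r⟩ (c r) ⟨hc.1 r, hc.2 r⟩
      set w : PiLp 2 (fun _ : Fin R => E) := WithLp.toLp 2 t with hw
      have hbw : ‖b - c - w‖ ≤ ε * ‖b - c‖ := norm_le_of_forall_norm_le hε.le hle
      have h2 := hC w ht
      have h3 : ‖b - c‖ ≤ ‖b - c - w‖ + ‖w‖ := by
        simpa using norm_add_le (b - c - w) w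
      have h4 : ‖addMap w‖ ≤ ‖addMap b - addMap c‖ + ‖addMap (b - c - w)‖ := by
        rw [addMap_sub, addMap_sub]
        simpa using norm_sub_le (addMap b - addMap c) (addMap b - addMap c - addMap w)
      have h5 := norm_addMap_le (b - c - w)
      have hR : (0 : ℝ) ≤ R := Nat.cast_nonneg R
      have h6 : ‖b - c‖ ≤ ε * ‖b - c‖ +
          C * (‖addMap b - addMap c‖ + R * (ε * ‖b - c‖)) := by
        refine h3.trans (add_le_add hbw (h2.trans ?_))
        gcongr
        exact h4.trans (add_le_add le_rfl (h5.trans (by gcongr)))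
      have h7 : (C' + C) / 2 * ‖b - c‖ ≤ C * (C' * ‖addMap b - addMap c‖) := by
        have h8 := mul_le_mul_of_nonneg_right hεC (norm_nonneg (b - c))
        have h9 := mul_le_mul_of_nonneg_left h6 hC'0.le
        linarith
      refine le_of_mul_le_mul_left (h7.trans ?_) (by positivity : 0 < (C' + C) / 2)
      gcongr
      linarith
  have hlim : Filter.Tendsto (fun C' : ℝ => ENNReal.ofReal C') (𝓝[>] C)
      (𝓝 (ENNReal.ofReal C)) :=
    (ENNReal.continuous_ofReal.tendsto C).mono_left nhdsWithin_le_nhds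
  exact ge_of_tendsto hlim (Filter.eventually_of_mem self_mem_nhdsWithin key)

theorem condNumber_le_condNumber {F : Type*} [NormedAddCommGroup F] [NormedSpace ℝ F]
    {M : Set E} {a : PiLp 2 (fun _ : Fin R => E)} (ha : a ∈ prodSet M R) {T : Fin R → Set E}
    (hT : ∀ r, IsTangentSet M (a r) (T r))
    {N : Set F} {b : PiLp 2 (fun _ : Fin R => F)} (hb : b ∈ prodSet N R) {S : Fin R → Set F}
    (hS : ∀ r, IsTangentSet N (b r) (S r))
    (h : ∀ C : ℝ, 0 ≤ C →
      (∀ v : PiLp 2 (fun _ : Fin R => F), (∀ r, v r ∈ S r) → ‖v‖ ≤ C * ‖addMap v‖) →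
      ∀ w : PiLp 2 (fun _ : Fin R => E), (∀ r, w r ∈ T r) → ‖w‖ ≤ C * ‖addMap w‖) :
    condNumber M a ≤ condNumber N b := by
  by_cases htop : condNumber N b = ⊤
  · rw [htop]; exact le_top
  · have hC0 : 0 ≤ (condNumber N b).toReal := ENNReal.toReal_nonneg
    rw [← ENNReal.ofReal_toReal htop]
    exact condNumber_le_of_norm_le ha hT hC0
      (h _ hC0 (norm_le_of_condNumber_le hb hS (ENNReal.ofReal_toReal htop).ge hC0))

end TangentVectors

/-! ### Inner products and derivatives of tensor powers -/

section MultilinearAlgebra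

open scoped RealInnerProductSpace

/-- A matrix with orthonormal columns, as a linear isometry of Euclidean spaces. -/
noncomputable def matrixIsometry {ι κ : Type*} [Fintype ι] [Fintype κ] [DecidableEq κ]
    (K : Matrix ι κ ℝ) (hK : Kᵀ * K = 1) : EuclideanSpace ℝ κ →ₗᵢ[ℝ] EuclideanSpace ℝ ι where
  toFun x := WithLp.toLp 2 (K *ᵥ x.ofLp)
  map_add' x y := by simp [Matrix.mulVec_add]
  map_smul' c x := by simp [Matrix.mulVec_smul]
  norm_map' x := by
    rw [← sq_eq_sq₀ (norm_nonneg _) (norm_nonneg _), ← real_inner_self_eq_norm_sq,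
      ← real_inner_self_eq_norm_sq, EuclideanSpace.inner_eq_star_dotProduct,
      EuclideanSpace.inner_eq_star_dotProduct]
    simp only [LinearMap.coe_mk, AddHom.coe_mk, star_trivial]
    rw [Matrix.dotProduct_mulVec, Matrix.vecMul_mulVec, hK, Matrix.vecMul_one]

variable {n m D : ℕ}

/-- The elementary tensor `f_1 ⊗ ⋯ ⊗ f_D`. -/
noncomputable def elemTensor (f : Fin D → EuclideanSpace ℝ (Fin n)) : Tensor n D :=
  WithLp.toLp 2 fun i => ∏ d, f d (i d)

theorem inner_elemTensor (f g : Fin D → EuclideanSpace ℝ (Fin n)) :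
    ⟪elemTensor f, elemTensor g⟫ = ∏ d, ⟪f d, g d⟫ := by
  simp only [PiLp.inner_apply, elemTensor, Finset.prod_univ_sum, Fintype.piFinset_univ]
  refine Finset.sum_congr rfl fun i _ => ?_
  simp [Finset.prod_mul_distrib]

theorem tensorPow_smul (c : ℝ) (a : EuclideanSpace ℝ (Fin n)) :
    tensorPow D (c • a) = c ^ D • tensorPow D a := by
  ext i
  simp [tensorPow, Finset.prod_mul_distrib]

theorem inner_tensorPow (a b : EuclideanSpace ℝ (Fin n)) :
    ⟪tensorPow D a, tensorPow D b⟫ = ⟪a, b⟫ ^ D := by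
  refine (inner_elemTensor _ _).trans ?_
  simp

/-- `a ⊗ ⋯ ⊗ u ⊗ ⋯ ⊗ a` with `u` in position `d`. -/
noncomputable def insertTensor (a : EuclideanSpace ℝ (Fin n)) (d : Fin D)
    (u : EuclideanSpace ℝ (Fin n)) : Tensor n D :=
  elemTensor (Function.update (fun _ => a) d u)

theorem inner_insertTensor_same (a b u v : EuclideanSpace ℝ (Fin n)) (d : Fin D) :
    ⟪insertTensor a d u, insertTensor b d v⟫ = ⟪u, v⟫ * ⟪a, b⟫ ^ (D - 1) := by
  rw [insertTensor, insertTensor, inner_elemTensor, ← Finset.mul_prod_erase _ _ (Finset.mem_univ d)]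
  simp only [Function.update_self]
  congr 1
  rw [Finset.prod_congr rfl (g := fun _ => ⟪a, b⟫)]
  · simp
  · intro e he
    simp [Finset.ne_of_mem_erase he]

theorem inner_insertTensor_ne (a b u v : EuclideanSpace ℝ (Fin n)) {d e : Fin D} (h : d ≠ e) :
    ⟪insertTensor a d u, insertTensor b e v⟫ = ⟪u, b⟫ * ⟪a, v⟫ * ⟪a, b⟫ ^ (D - 2) := by
  rw [insertTensor, insertTensor, inner_elemTensor, ← Finset.mul_prod_erase _ _ (Finset.mem_univ d),
    ← Finset.mul_prod_erase _ _ (Finset.mem_erase.2 ⟨h.symm, Finset.mem_univ e⟩), ← mul_assoc]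
  simp only [Function.update_self, Function.update_of_ne h, Function.update_of_ne h.symm]
  congr 1
  rw [Finset.prod_congr rfl (g := fun _ => ⟪a, b⟫)]
  · rw [Finset.prod_const, Finset.card_erase_of_mem (Finset.mem_erase.2 ⟨h.symm, Finset.mem_univ e⟩),
      Finset.card_erase_of_mem (Finset.mem_univ d), Finset.card_univ, Fintype.card_fin, Nat.sub_sub]
  · intro x hx
    simp [Finset.ne_of_mem_erase hx, Finset.ne_of_mem_erase (Finset.mem_of_mem_erase hx)]

theorem inner_tensorPow_insertTensor (a b u : EuclideanSpace ℝ (Fin n)) (d : Fin D) :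
    ⟪tensorPow D a, insertTensor b d u⟫ = ⟪a, u⟫ * ⟪a, b⟫ ^ (D - 1) := by
  have h := inner_insertTensor_same a b a u d
  rwa [insertTensor, Function.update_eq_self] at h

/-- `∑_d a ⊗ ⋯ ⊗ u ⊗ ⋯ ⊗ a`, the derivative of `a ↦ a^{⊗D}` in direction `u`. -/
noncomputable def symTensor (D : ℕ) (a u : EuclideanSpace ℝ (Fin n)) : Tensor n D :=
  ∑ d, insertTensor a d u

/-- There are `D` pairs of equal positions and `D (D - 1)` pairs of distinct ones. The second term
vanishes as soon as `u ⊥ b` or `v ⊥ a`. For `D ≤ 1` its coefficient is zero, so the truncated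
exponent `D - 2` is harmless. -/
theorem inner_symTensor (a b u v : EuclideanSpace ℝ (Fin n)) :
    ⟪symTensor D a u, symTensor D b v⟫ = D * (⟪u, v⟫ * ⟪a, b⟫ ^ (D - 1)) +
      D * (D - 1) * (⟪u, b⟫ * ⟪a, v⟫ * ⟪a, b⟫ ^ (D - 2)) := by
  have key : ∀ d e : Fin D, ⟪insertTensor a d u, insertTensor b e v⟫ =
      ⟪u, b⟫ * ⟪a, v⟫ * ⟪a, b⟫ ^ (D - 2) + if d = e then ⟪u, v⟫ * ⟪a, b⟫ ^ (D - 1) -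
        ⟪u, b⟫ * ⟪a, v⟫ * ⟪a, b⟫ ^ (D - 2) else 0 := by
    intro d e
    split_ifs with h
    · subst h
      rw [inner_insertTensor_same]; ring
    · rw [inner_insertTensor_ne _ _ _ _ h]; ring
  simp only [symTensor, sum_inner, inner_sum, key, Finset.sum_add_distrib, Finset.sum_ite_eq',
    Finset.mem_univ, if_true, Finset.sum_const, Finset.card_univ, Fintype.card_fin, nsmul_eq_mul]
  ring

theorem insertTensor_apply (a u : EuclideanSpace ℝ (Fin n)) (d : Fin D) (i : Fin D → Fin n) :
    insertTensor a d u i = (∏ e ∈ Finset.univ.erase d, a (i e)) * u (i d) := by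
  change ∏ e, (Function.update (fun _ => a) d u : Fin D → EuclideanSpace ℝ (Fin n)) e (i e) = _
  rw [← Finset.mul_prod_erase _ _ (Finset.mem_univ d), mul_comm, Function.update_self]
  congr 1
  exact Finset.prod_congr rfl fun e he => by simp [Finset.ne_of_mem_erase he]

theorem symTensor_apply (a u : EuclideanSpace ℝ (Fin n)) (i : Fin D → Fin n) :
    symTensor D a u i = ∑ d, (∏ e ∈ Finset.univ.erase d, a (i e)) * u (i d) := by
  simp [symTensor, insertTensor_apply]

theorem symTensor_add (a u v : EuclideanSpace ℝ (Fin n)) :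
    symTensor D a (u + v) = symTensor D a u + symTensor D a v := by
  ext i
  simp [symTensor_apply, mul_add, Finset.sum_add_distrib]

theorem symTensor_smul (c : ℝ) (a u : EuclideanSpace ℝ (Fin n)) :
    symTensor D a (c • u) = c • symTensor D a u := by
  ext i
  simp [symTensor_apply, Finset.mul_sum, mul_left_comm]

theorem symTensor_smul_left (c : ℝ) (a u : EuclideanSpace ℝ (Fin n)) :
    symTensor D (c • a) u = c ^ (D - 1) • symTensor D a u := by
  ext i
  simp [symTensor_apply, Finset.mul_sum, Finset.prod_mul_distrib, mul_assoc]

theorem symTensor_self (a : EuclideanSpace ℝ (Fin n)) :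
    symTensor D a a = (D : ℝ) • tensorPow D a := by
  ext i
  simp [symTensor_apply, Finset.prod_erase_mul, tensorPow]

/-- Strict differentiability is what the two-point condition in `IsTangentSet` calls for. -/
theorem hasStrictFDerivAt_tensorPow (a : EuclideanSpace ℝ (Fin n)) :
    ∃ L : EuclideanSpace ℝ (Fin n) →L[ℝ] Tensor n D,
      (∀ u, L u = symTensor D a u) ∧ HasStrictFDerivAt (tensorPow D) L a := by
  let L₀ : EuclideanSpace ℝ (Fin n) →ₗ[ℝ] Tensor n D :=
    { toFun := symTensor D a
      map_add' := symTensor_add a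
      map_smul' := fun c u => symTensor_smul c a u }
  refine ⟨L₀.toContinuousLinearMap, fun u => rfl, ?_⟩
  rw [hasStrictFDerivAt_euclidean]
  intro i
  have h := HasStrictFDerivAt.finsetProd (u := Finset.univ) (x := a)
    (g := fun (d : Fin D) (x : EuclideanSpace ℝ (Fin n)) => x (i d))
    (g' := fun d => EuclideanSpace.proj (𝕜 := ℝ) (i d))
    fun d _ => (EuclideanSpace.proj (𝕜 := ℝ) (i d)).hasStrictFDerivAt
  refine h.congr_fderiv ?_
  ext u
  simp [L₀, symTensor_apply]

/-- The matrix of the multilinear multiplication `Q^{⊗D}`. -/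
def kroneckerPow (D : ℕ) (Q : Matrix (Fin n) (Fin m) ℝ) :
    Matrix (Fin D → Fin n) (Fin D → Fin m) ℝ :=
  Matrix.of fun i j => ∏ d, Q (i d) (j d)

theorem kroneckerPow_transpose_mul_self {Q : Matrix (Fin n) (Fin m) ℝ} (hQ : Qᵀ * Q = 1) :
    (kroneckerPow D Q)ᵀ * kroneckerPow D Q = 1 := by
  ext i j
  have h : ∀ a b, ∑ k, Q k a * Q k b = (1 : Matrix (Fin m) (Fin m) ℝ) a b := fun a b => by
    rw [← hQ]; rfl
  simp only [kroneckerPow, Matrix.mul_apply, Matrix.transpose_apply, Matrix.of_apply,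
    ← Finset.prod_mul_distrib]
  have h2 := Finset.prod_univ_sum (fun _ : Fin D => (Finset.univ : Finset (Fin n)))
    fun d k => Q k (i d) * Q k (j d)
  rw [Fintype.piFinset_univ] at h2
  rw [← h2]
  simp only [h, Matrix.one_apply]
  rw [Fintype.prod_ite_zero]
  simp [funext_iff]

theorem tuckerMul_eq_matrixIsometry {Q : Matrix (Fin n) (Fin m) ℝ} (hQ : Qᵀ * Q = 1)
    (T : Tensor m D) :
    tuckerMul D Q T =
      matrixIsometry (kroneckerPow D Q) (kroneckerPow_transpose_mul_self hQ) T := rfl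

theorem tuckerMul_smul_tensorPow {Q : Matrix (Fin n) (Fin m) ℝ} (hQ : Qᵀ * Q = 1) (c : ℝ)
    (a : EuclideanSpace ℝ (Fin m)) :
    tuckerMul D Q (c • tensorPow D a) = c • tensorPow D (matrixIsometry Q hQ a) := by
  rw [tuckerMul_eq_matrixIsometry hQ, map_smul, ← tuckerMul_eq_matrixIsometry hQ]
  congr 1
  ext i
  have h2 := Finset.prod_univ_sum (fun _ : Fin D => (Finset.univ : Finset (Fin m)))
    fun d k => Q (i d) k * a k
  rw [Fintype.piFinset_univ] at h2
  simp only [Finset.prod_mul_distrib] at h2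
  exact h2.symm

end MultilinearAlgebra

/-! ### Tangent spaces of the Veronese manifold -/

section Veronese

open scoped RealInnerProductSpace

variable {n m D R : ℕ}

/-- The contraction of a tensor with `a` in all positions except `d`. -/
noncomputable def contract (a : EuclideanSpace ℝ (Fin n)) (d : Fin D) :
    Tensor n D →L[ℝ] EuclideanSpace ℝ (Fin n) :=
  (EuclideanSpace.equiv (Fin n) ℝ).symm.toContinuousLinearMap ∘L
    ContinuousLinearMap.pi fun k => innerSL ℝ (insertTensor a d (EuclideanSpace.single k 1))

/-- Contraction recovers the direction of a rank-one tensor, so it serves as a linear chart of the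
Veronese manifold near a multiple of `a^{⊗D}`. -/
theorem contract_tensorPow (a b : EuclideanSpace ℝ (Fin n)) (d : Fin D) :
    contract a d (tensorPow D b) = ⟪b, a⟫ ^ (D - 1) • b := by
  ext k
  change ⟪insertTensor a d (EuclideanSpace.single k 1), tensorPow D b⟫ = _
  rw [real_inner_comm, inner_tensorPow_insertTensor]
  simp [EuclideanSpace.inner_single_right, mul_comm]

theorem tensorPow_mem_veronese {c : ℝ} (hc : c ≠ 0) {v : EuclideanSpace ℝ (Fin n)} (hv : v ≠ 0) :
    c • tensorPow D v ∈ veronese n D := by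
  have hv' : ‖v‖ ≠ 0 := norm_ne_zero_iff.2 hv
  refine ⟨c * ‖v‖ ^ D, ‖v‖⁻¹ • v, mul_ne_zero hc (pow_ne_zero _ hv'), ?_, ?_⟩
  · rw [norm_smul, norm_inv, norm_norm, inv_mul_cancel₀ hv']
  · rw [tensorPow_smul, smul_smul, mul_assoc, ← mul_pow, mul_inv_cancel₀ hv', one_pow, mul_one]

/-- The tangent space of the Veronese manifold at `α a^{⊗D}`. -/
theorem isTangentSet_veronese (hD : 1 ≤ D) {α : ℝ} (hα : α ≠ 0) {a : EuclideanSpace ℝ (Fin n)}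
    (ha : ‖a‖ = 1) :
    IsTangentSet (veronese n D) (α • tensorPow D a) (Set.range (symTensor D a)) := by
  have haa : ⟪a, a⟫ = (1 : ℝ) := by rw [real_inner_self_eq_norm_sq, ha, one_pow]
  have ha0 : a ≠ 0 := by rintro rfl; simp at ha
  constructor
  · rintro _ ⟨u, rfl⟩
    obtain ⟨L, hL, hLd⟩ := hasStrictFDerivAt_tensorPow (D := D) a
    have hline : HasDerivAt (fun s : ℝ => a + s • (α⁻¹ • u)) (α⁻¹ • u) 0 := by
      simpa using ((hasDerivAt_id (0 : ℝ)).smul_const (α⁻¹ • u)).const_add a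
    refine ⟨fun s => α • tensorPow D (a + s • (α⁻¹ • u)), ?_, by simp, ?_⟩
    · have hLd' : HasFDerivAt (tensorPow D) L (a + (0 : ℝ) • (α⁻¹ • u)) := by
        simpa using hLd.hasFDerivAt
      have h := (hLd'.comp_hasDerivAt 0 hline).const_smul α
      rwa [map_smul, smul_smul, mul_inv_cancel₀ hα, one_smul, hL] at h
    · have h1 : ∀ᶠ s in 𝓝 (0 : ℝ), a + s • (α⁻¹ • u) ≠ 0 :=
        hline.continuousAt.eventually_ne (by simpa using ha0)
      filter_upwards [h1] with s hs using tensorPow_mem_veronese hα hs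
  · intro ε hε
    let d : Fin D := ⟨0, hD⟩
    set v₀ := contract a d (α • tensorPow D a) with hv₀
    have hv₀' : v₀ = α • a := by
      rw [hv₀, map_smul, contract_tensorPow, haa, one_pow, one_smul]
    obtain ⟨L, hL, hLd⟩ := hasStrictFDerivAt_tensorPow (D := D) v₀
    have hne : ⟪a, v₀⟫ ^ (D - 1) ≠ 0 := by
      rw [hv₀', inner_smul_right, haa, mul_one]; exact pow_ne_zero _ hα
    obtain ⟨ℓ, hℓ⟩ : ∃ ℓ : EuclideanSpace ℝ (Fin n) →L[ℝ] ℝ,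
        HasStrictFDerivAt (fun v => (⟪a, v⟫ ^ (D - 1))⁻¹) ℓ v₀ := by
      have h1 : HasStrictFDerivAt (fun v => ⟪a, v⟫) (innerSL ℝ a) v₀ :=
        (innerSL ℝ a).hasStrictFDerivAt
      exact ⟨_, (hasStrictDerivAt_inv hne).comp_hasStrictFDerivAt v₀ (h1.pow (D - 1))⟩
    -- Inverse of the chart: for `v = β ⟪b, a⟫^(D-1) b`, dividing `v^{⊗D}` by `⟪a, v⟫^(D-1)` gives
    -- back `β b^{⊗D}`.
    set φ : EuclideanSpace ℝ (Fin n) → Tensor n D :=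
      fun v => (⟪a, v⟫ ^ (D - 1))⁻¹ • tensorPow D v with hφ
    have hφd := hℓ.smul hLd
    set φ' := (⟪a, v₀⟫ ^ (D - 1))⁻¹ • L + ℓ.smulRight (tensorPow D v₀) with hφ'
    -- The derivative of the scalar factor contributes a multiple of `a^{⊗D}`, which is tangent
    -- because `symTensor D a a = D • a^{⊗D}`.
    have hrange : ∀ v, φ' v ∈ Set.range (symTensor D a) := by
      intro v
      have hD0 : (D : ℝ) ≠ 0 := by positivity
      refine ⟨((⟪a, v₀⟫ ^ (D - 1))⁻¹ * α ^ (D - 1)) • v + (ℓ v * α ^ D * (D : ℝ)⁻¹) • a, ?_⟩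
      rw [symTensor_add, symTensor_smul, symTensor_smul, symTensor_self, smul_smul, mul_assoc _ _ (D : ℝ),
        inv_mul_cancel₀ hD0, mul_one]
      simp only [hφ', add_apply, smul_apply,
        ContinuousLinearMap.smulRight_apply, hL]
      rw [hv₀', symTensor_smul_left, tensorPow_smul, smul_smul, smul_smul]
    have hinv : ∀ᶠ x in 𝓝 (α • tensorPow D a), x ∈ veronese n D → φ (contract a d x) = x := by
      have h1 : ContinuousAt (fun x : Tensor n D => ⟪x, tensorPow D a⟫) (α • tensorPow D a) := by
        fun_prop
      have h2 : ⟪α • tensorPow D a, tensorPow D a⟫ ≠ 0 := by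
        rw [inner_smul_left, inner_tensorPow, haa]; simpa using hα
      filter_upwards [h1.eventually_ne h2] with x hx
      rintro ⟨β, b, hβ, -, rfl⟩
      rw [inner_smul_left, inner_tensorPow] at hx
      have hab : ⟪b, a⟫ ≠ 0 := by
        intro h0
        rw [h0, zero_pow (by lia)] at hx
        simp at hx
      simp only [hφ, map_smul, contract_tensorPow, tensorPow_smul, inner_smul_right, smul_smul]
      rw [real_inner_comm b a]
      congr 1
      obtain ⟨k, rfl⟩ : ∃ k, D = k + 1 := ⟨D - 1, by lia⟩
      rw [Nat.add_sub_cancel]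
      field_simp
      ring
    have hcont : ContinuousAt (contract a d) (α • tensorPow D a) := by fun_prop
    have hπ : Filter.Tendsto (fun p : Tensor n D × Tensor n D => (contract a d p.1, contract a d p.2))
        (𝓝 (α • tensorPow D a) ×ˢ 𝓝 (α • tensorPow D a)) (𝓝 (v₀, v₀)) := by
      rw [nhds_prod_eq]
      exact hcont.tendsto.prodMap hcont.tendsto
    -- The added `1` keeps `ε / K` meaningful should the contraction have norm zero.
    set K := ‖contract a d‖ + 1 with hK
    have hKpos : 0 < K := by positivity
    have hs := hπ.eventually (hφd.isLittleO.bound (div_pos hε hKpos))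
    filter_upwards [hs, hinv.prod_mk hinv] with p hp hq hp1 hp2
    refine ⟨φ' (contract a d p.1 - contract a d p.2), hrange _, ?_⟩
    have hp' : ‖φ (contract a d p.1) - φ (contract a d p.2) -
        φ' (contract a d p.1 - contract a d p.2)‖ ≤
        ε / K * ‖contract a d p.1 - contract a d p.2‖ := hp
    rw [hq.1 hp1, hq.2 hp2] at hp'
    refine hp'.trans ?_
    rw [← map_sub]
    have h3 := (contract a d).le_opNorm (p.1 - p.2)
    calc ε / K * ‖contract a d (p.1 - p.2)‖ ≤ ε / K * (K * ‖p.1 - p.2‖) := by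
          gcongr
          exact h3.trans (by gcongr; rw [hK]; linarith)
      _ = ε * ‖p.1 - p.2‖ := by field_simp

end Veronese

/-! ### Invariance of the tangent estimates under orthogonal compression -/

section Compression

open scoped RealInnerProductSpace

variable {n m D R : ℕ}

theorem norm_sq_sum_eq {ι E : Type*} [Fintype ι] [NormedAddCommGroup E] [InnerProductSpace ℝ E]
    (f : ι → E) : ‖∑ r, f r‖ ^ 2 = ∑ r, ∑ s, ⟪f r, f s⟫ := by
  rw [← real_inner_self_eq_norm_sq, sum_inner]
  simp only [inner_sum]

/-- Averaging over an orthonormal basis of directions removes the second-order term. -/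
theorem sum_inner_symTensor_smul_basis (a b : EuclideanSpace ℝ (Fin m)) (c e : ℝ) :
    ∑ j, ⟪symTensor D a (c • EuclideanSpace.basisFun (Fin m) ℝ j),
      symTensor D b (e • EuclideanSpace.basisFun (Fin m) ℝ j)⟫ =
      (D * m + D * (D - 1)) * (c * e * ⟪a, b⟫ ^ (D - 1)) := by
  set β := EuclideanSpace.basisFun (Fin m) ℝ
  have h1 : ∀ j, ⟪symTensor D a (c • β j), symTensor D b (e • β j)⟫ =
      D * (c * e * ⟪a, b⟫ ^ (D - 1)) +
        D * (D - 1) * (c * e * ⟪a, b⟫ ^ (D - 2)) * (⟪a, β j⟫ * ⟪β j, b⟫) := by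
    intro j
    rw [inner_symTensor]
    simp only [inner_smul_left, inner_smul_right, real_inner_self_eq_norm_sq, β.norm_eq_one,
      RCLike.conj_to_real]
    ring
  simp only [h1, Finset.sum_add_distrib, ← Finset.mul_sum, β.sum_inner_mul_inner,
    Finset.sum_const, Finset.card_univ, Fintype.card_fin, nsmul_eq_mul]
  -- For `D ≥ 2` Parseval supplies the factor `⟪a, b⟫` that raises the exponent `D - 2` to `D - 1`;
  -- for `D ≤ 1` that term has coefficient zero.
  rcases D with _ | _ | k
  · simp
  · simp; ring
  · simp only [Nat.add_sub_cancel]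
    push_cast
    ring

/-- A lower bound for sums of tangent vectors of the Veronese manifold gives one for the Gram
matrix of the points `x_r^{⊗(D-1)}`. -/
theorem sum_sq_le_gram (hD : 1 ≤ D) {x : Fin R → EuclideanSpace ℝ (Fin m)} (hx : ∀ r, ‖x r‖ = 1)
    {C : ℝ} (h : ∀ y : Fin R → EuclideanSpace ℝ (Fin m),
      ∑ r, ‖symTensor D (x r) (y r)‖ ^ 2 ≤ C ^ 2 * ‖∑ r, symTensor D (x r) (y r)‖ ^ 2)
    (c : Fin R → ℝ) :
    ∑ r, c r ^ 2 ≤ C ^ 2 * ∑ r, ∑ s, c r * c s * ⟪x r, x s⟫ ^ (D - 1) := by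
  rcases isEmpty_or_nonempty (Fin R) with hR | ⟨⟨r₀⟩⟩
  · simp
  -- A unit vector exists, so `m > 0`; this makes the common factor `D m + D (D - 1)` positive, and
  -- it can be cancelled.
  have hm : 0 < m := by
    rcases Nat.eq_zero_or_pos m with rfl | hm
    · have := hx r₀
      rw [Subsingleton.elim (x r₀) 0, norm_zero] at this
      exact absurd this zero_ne_one
    · exact hm
  set β := EuclideanSpace.basisFun (Fin m) ℝ with hβ
  have h1 := Finset.sum_le_sum fun j (_ : j ∈ Finset.univ) => h fun r => c r • β j
  rw [← Finset.mul_sum] at h1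
  simp only [norm_sq_sum_eq] at h1
  have h2 : ∑ j, ∑ r, ‖symTensor D (x r) (c r • β j)‖ ^ 2 =
      (D * m + D * (D - 1)) * ∑ r, c r ^ 2 := by
    rw [Finset.sum_comm, Finset.mul_sum]
    refine Finset.sum_congr rfl fun r _ => ?_
    simp only [← real_inner_self_eq_norm_sq]
    rw [sum_inner_symTensor_smul_basis, real_inner_self_eq_norm_sq, hx, one_pow, one_pow]
    ring
  have h3 : ∑ j, ∑ r, ∑ s, ⟪symTensor D (x r) (c r • β j), symTensor D (x s) (c s • β j)⟫ =
      (D * m + D * (D - 1)) * ∑ r, ∑ s, c r * c s * ⟪x r, x s⟫ ^ (D - 1) := by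
    rw [Finset.sum_comm, Finset.mul_sum]
    refine Finset.sum_congr rfl fun r _ => ?_
    rw [Finset.sum_comm, Finset.mul_sum]
    exact Finset.sum_congr rfl fun s _ => sum_inner_symTensor_smul_basis _ _ _ _
  rw [h2, h3, mul_left_comm] at h1
  have hD' : (1 : ℝ) ≤ D := by exact_mod_cast hD
  have hm' : (0 : ℝ) < m := by exact_mod_cast hm
  refine le_of_mul_le_mul_left h1 (add_pos_of_pos_of_nonneg (by positivity) ?_)
  exact mul_nonneg (by linarith) (by linarith)

theorem exists_inner_eq_zero_add {E F : Type*} [NormedAddCommGroup E] [InnerProductSpace ℝ E]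
    [NormedAddCommGroup F] [InnerProductSpace ℝ F] [FiniteDimensional ℝ E] [FiniteDimensional ℝ F]
    (L : E →ₗᵢ[ℝ] F) (u : F) : ∃ y z, u = L y + z ∧ ∀ x, ⟪z, L x⟫ = 0 := by
  refine ⟨LinearMap.adjoint L.toLinearMap u, u - L (LinearMap.adjoint L.toLinearMap u), by simp,
    fun x => ?_⟩
  rw [inner_sub_left, L.inner_map_map, LinearMap.adjoint_inner_left]
  simp

/-- Write `u r = L (y r) + z r` with `z r` orthogonal to the range of `L`. The Gram matrix splits
into that of the `symTensor D (x r) (y r)`, covered by `h`, and one summand per coordinate of the `z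
r`, covered by `sum_sq_le_gram` with the same `C`. -/
theorem sum_norm_sq_symTensor_map_le (hD : 1 ≤ D)
    (L : EuclideanSpace ℝ (Fin m) →ₗᵢ[ℝ] EuclideanSpace ℝ (Fin n))
    {x : Fin R → EuclideanSpace ℝ (Fin m)} (hx : ∀ r, ‖x r‖ = 1)
    {C : ℝ} (h : ∀ y : Fin R → EuclideanSpace ℝ (Fin m),
      ∑ r, ‖symTensor D (x r) (y r)‖ ^ 2 ≤ C ^ 2 * ‖∑ r, symTensor D (x r) (y r)‖ ^ 2)
    (u : Fin R → EuclideanSpace ℝ (Fin n)) :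
    ∑ r, ‖symTensor D (L (x r)) (u r)‖ ^ 2 ≤
      C ^ 2 * ‖∑ r, symTensor D (L (x r)) (u r)‖ ^ 2 := by
  choose y z hu hz using fun r => exists_inner_eq_zero_add L (u r)
  have hz' : ∀ r v, ⟪L v, z r⟫ = 0 := fun r v => by rw [real_inner_comm, hz]
  have hinner : ∀ r s, ⟪symTensor D (L (x r)) (u r), symTensor D (L (x s)) (u s)⟫ =
      ⟪symTensor D (x r) (y r), symTensor D (x s) (y s)⟫ +
        D * ∑ k, z r k * z s k * ⟪x r, x s⟫ ^ (D - 1) := by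
    intro r s
    have hzz : ⟪z r, z s⟫ = ∑ k, z r k * z s k := by
      rw [PiLp.inner_apply]
      exact Finset.sum_congr rfl fun k _ => mul_comm _ _
    rw [inner_symTensor, inner_symTensor, hu r, hu s, ← Finset.sum_mul, ← hzz]
    simp only [inner_add_left, inner_add_right, hz, hz', L.inner_map_map]
    ring
  have h1 := h y
  have h2 : ∑ k, ∑ r, z r k ^ 2 ≤
      C ^ 2 * ∑ r, ∑ s, ∑ k, z r k * z s k * ⟪x r, x s⟫ ^ (D - 1) := by
    refine (Finset.sum_le_sum fun k _ => sum_sq_le_gram hD hx h fun r => z r k).trans_eq ?_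
    rw [← Finset.mul_sum, Finset.sum_comm]
    congr 1
    exact Finset.sum_congr rfl fun r _ => Finset.sum_comm
  have h3 : ∑ r, ‖symTensor D (L (x r)) (u r)‖ ^ 2 =
      ∑ r, ‖symTensor D (x r) (y r)‖ ^ 2 + D * ∑ k, ∑ r, z r k ^ 2 := by
    rw [Finset.sum_comm, Finset.mul_sum, ← Finset.sum_add_distrib]
    refine Finset.sum_congr rfl fun r _ => ?_
    rw [← real_inner_self_eq_norm_sq, hinner, real_inner_self_eq_norm_sq,
      real_inner_self_eq_norm_sq, hx]
    simp [sq]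
  rw [h3, norm_sq_sum_eq]
  simp only [hinner, Finset.sum_add_distrib, ← Finset.mul_sum]
  rw [← norm_sq_sum_eq, mul_add]
  refine add_le_add h1 ?_
  rw [mul_left_comm]
  gcongr

/-- Restrict to directions `L (y r)`: the inner products of `symTensor` depend only on those of the
vectors, which `L` preserves. -/
theorem sum_norm_sq_symTensor_le_of_map
    (L : EuclideanSpace ℝ (Fin m) →ₗᵢ[ℝ] EuclideanSpace ℝ (Fin n))
    {x : Fin R → EuclideanSpace ℝ (Fin m)} {C : ℝ}
    (h : ∀ u : Fin R → EuclideanSpace ℝ (Fin n), ∑ r, ‖symTensor D (L (x r)) (u r)‖ ^ 2 ≤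
      C ^ 2 * ‖∑ r, symTensor D (L (x r)) (u r)‖ ^ 2)
    (y : Fin R → EuclideanSpace ℝ (Fin m)) :
    ∑ r, ‖symTensor D (x r) (y r)‖ ^ 2 ≤ C ^ 2 * ‖∑ r, symTensor D (x r) (y r)‖ ^ 2 := by
  have h1 := h fun r => L (y r)
  simpa only [← real_inner_self_eq_norm_sq, norm_sq_sum_eq, sum_inner, inner_sum, inner_symTensor,
    L.inner_map_map] using h1

theorem forall_norm_le_iff_sum_sq_le {C : ℝ} (hC : 0 ≤ C)
    (x : Fin R → EuclideanSpace ℝ (Fin n)) :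
    (∀ w : PiLp 2 (fun _ : Fin R => Tensor n D), (∀ r, w r ∈ Set.range (symTensor D (x r))) →
      ‖w‖ ≤ C * ‖addMap w‖) ↔
    ∀ y : Fin R → EuclideanSpace ℝ (Fin n),
      ∑ r, ‖symTensor D (x r) (y r)‖ ^ 2 ≤ C ^ 2 * ‖∑ r, symTensor D (x r) (y r)‖ ^ 2 := by
  constructor
  · intro h y
    have h1 := h (WithLp.toLp 2 fun r => symTensor D (x r) (y r)) fun r => ⟨y r, rfl⟩
    have h2 := pow_le_pow_left₀ (norm_nonneg _) h1 2
    rwa [mul_pow, PiLp.norm_sq_eq_of_L2] at h2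
  · intro h w hw
    choose y hy using hw
    refine le_of_sq_le_sq ?_ (by positivity)
    rw [mul_pow, PiLp.norm_sq_eq_of_L2]
    simpa only [hy, addMap] using h y

/-- The map `Q^{⊗D}` is a linear isometry carrying tangent sets to tangent sets, so both tangent
estimates are the same. -/
theorem condNumber_compressedVeronese (hD : 1 ≤ D) {G : PiLp 2 (fun _ : Fin R => Tensor m D)}
    (hG : ∀ r, G r ∈ veronese m D) {Q : Matrix (Fin n) (Fin m) ℝ} (hQ : Qᵀ * Q = 1) :
    condNumber (compressedVeronese Q D) (tuckerMulEach Q G) = condNumber (veronese m D) G := by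
  choose α x hα hx hGx using hG
  have hT : ∀ r, IsTangentSet (veronese m D) (G r) (Set.range (symTensor D (x r))) := fun r => by
    rw [hGx r]; exact isTangentSet_veronese hD (hα r) (hx r)
  set L := matrixIsometry (kroneckerPow D Q) (kroneckerPow_transpose_mul_self hQ) with hL
  have hS : ∀ r, IsTangentSet (compressedVeronese Q D) (tuckerMulEach Q G r)
      (L '' Set.range (symTensor D (x r))) := fun r => (hT r).image L
  have hGm : G ∈ prodSet (veronese m D) R := fun r => ⟨α r, x r, hα r, hx r, hGx r⟩
  have hAm : tuckerMulEach Q G ∈ prodSet (compressedVeronese Q D) R := fun r => ⟨G r, hGm r, rfl⟩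
  have hnorm : ∀ w : PiLp 2 (fun _ : Fin R => Tensor m D),
      ‖(WithLp.toLp 2 fun r => L (w r) : PiLp 2 (fun _ : Fin R => Tensor n D))‖ = ‖w‖ ∧
        ‖addMap (WithLp.toLp 2 fun r => L (w r) : PiLp 2 (fun _ : Fin R => Tensor n D))‖ =
          ‖addMap w‖ := by
    refine fun w => ⟨?_, ?_⟩
    · simp only [PiLp.norm_eq_of_L2, L.norm_map]
    · simp only [addMap, ← map_sum, L.norm_map]
  refine le_antisymm (condNumber_le_condNumber hAm hS hGm hT ?_)
    (condNumber_le_condNumber hGm hT hAm hS ?_)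
  · intro C _ h w hw
    choose v hv hvw using hw
    have h1 := h (WithLp.toLp 2 v) hv
    rw [← (hnorm _).1, ← (hnorm (WithLp.toLp 2 v)).2] at h1
    simpa only [hvw] using h1
  · intro C _ h w hw
    have h1 := h (WithLp.toLp 2 fun r => L (w r)) fun r => ⟨w r, hw r, rfl⟩
    rwa [(hnorm w).1, (hnorm w).2] at h1

/-- The condition number of a Waring decomposition is invariant under orthogonal compression. -/
theorem condNumber_veronese_tuckerMulEach (hD : 1 ≤ D)
    {G : PiLp 2 (fun _ : Fin R => Tensor m D)}
    (hG : ∀ r, G r ∈ veronese m D) {Q : Matrix (Fin n) (Fin m) ℝ} (hQ : Qᵀ * Q = 1) :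
    condNumber (veronese n D) (tuckerMulEach Q G) = condNumber (veronese m D) G := by
  choose α x hα hx hGx using hG
  set L := matrixIsometry Q hQ with hL
  have hLx : ∀ r, ‖L (x r)‖ = 1 := fun r => by rw [L.norm_map, hx]
  have hA : ∀ r, tuckerMulEach Q G r = α r • tensorPow D (L (x r)) := fun r => by
    change tuckerMul D Q (G r) = _
    rw [hGx r, tuckerMul_smul_tensorPow hQ]
  have hT : ∀ r, IsTangentSet (veronese m D) (G r) (Set.range (symTensor D (x r))) := fun r => by
    rw [hGx r]; exact isTangentSet_veronese hD (hα r) (hx r)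
  have hS : ∀ r, IsTangentSet (veronese n D) (tuckerMulEach Q G r)
      (Set.range (symTensor D (L (x r)))) := fun r => by
    rw [hA r]; exact isTangentSet_veronese hD (hα r) (hLx r)
  have hGm : G ∈ prodSet (veronese m D) R := fun r => ⟨α r, x r, hα r, hx r, hGx r⟩
  have hAm : tuckerMulEach Q G ∈ prodSet (veronese n D) R :=
    fun r => ⟨α r, L (x r), hα r, hLx r, hA r⟩
  refine le_antisymm (condNumber_le_condNumber hAm hS hGm hT ?_)
    (condNumber_le_condNumber hGm hT hAm hS ?_)
  · intro C hC h
    rw [forall_norm_le_iff_sum_sq_le hC] at h ⊢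
    exact sum_norm_sq_symTensor_map_le hD L hx h
  · intro C hC h
    rw [forall_norm_le_iff_sum_sq_le hC] at h
    rw [forall_norm_le_iff_sum_sq_le hC]
    exact sum_norm_sq_symTensor_le_of_map L h

end Compression

end WaringCond

theorem theorem1 {m n D R : ℕ} (hD : 1 ≤ D)
    (G : PiLp 2 (fun _ : Fin R => WaringCond.Tensor m D))
    (hG : ∀ r, G r ∈ WaringCond.veronese m D)
    (Q : Matrix (Fin n) (Fin m) ℝ) (hQ : Qᵀ * Q = 1)
    (A : PiLp 2 (fun _ : Fin R => WaringCond.Tensor n D))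
    (hA : A = WaringCond.tuckerMulEach Q G) :
    (WaringCond.condNumber (WaringCond.compressedVeronese Q D) A ≤
        WaringCond.condNumber (WaringCond.veronese n D) A ∧
      WaringCond.condNumber (WaringCond.veronese n D) A ≤
        ENNReal.ofReal (Real.sqrt D) * WaringCond.condNumber (WaringCond.veronese m D) G ∧
      WaringCond.condNumber (WaringCond.veronese m D) G =
        WaringCond.condNumber (WaringCond.compressedVeronese Q D) A) ∧
    ∀ (l : ℕ) (U : Matrix (Fin l) (Fin m) ℝ) (_ : Uᵀ * U = 1)
      (B : PiLp 2 (fun _ : Fin R => WaringCond.Tensor l D))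
      (_ : B = WaringCond.tuckerMulEach U G), m < min l n →
      WaringCond.condNumber (WaringCond.veronese n D) A =
        WaringCond.condNumber (WaringCond.veronese l D) B := by
  subst hA
  have hA := WaringCond.condNumber_veronese_tuckerMulEach hD hG hQ
  have hW := WaringCond.condNumber_compressedVeronese hD hG hQ
  refine ⟨⟨(hW.trans hA.symm).le, ?_, hW.symm⟩, ?_⟩
  · rw [hA]
    -- The two condition numbers are equal, so `√D ≥ 1` suffices.
    refine le_mul_of_one_le_left zero_le ?_
    rw [ENNReal.one_le_ofReal, Real.one_le_sqrt]
    exact_mod_cast hD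
  · rintro l U hU B rfl -
    rw [hA, WaringCond.condNumber_veronese_tuckerMulEach hD hG hU]
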